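/- Let $a,b,c\in\mathbb R$ and let $\Omega\subset\mathbb R^2$ be a domain (a nonempty connected open set) contained in the half-strip $[a,\infty)\times(b,c)$. Let $u_1,u_2:\Omega\to\mathbb R$ be ($C^2$) solutions of the translator equation $$\operatorname{Div}\left(\frac{Du}{\sqrt{1+|Du|^2}}\right)=-\frac{1}{\sqrt{1+|Du|^2}}$$ that extend continuously to $\partial\Omega$, and suppose that $u_2-u_1=d$ on $\partial\Omega$ for some constant $d\in\mathbb R$. For $i=1,2$ let $$\nu_i=\frac{1}{\sqrt{1+|Du_i|^2}}\left(-\frac{\partial u_i}{\partial x},-\frac{\partial u_i}{\partial y},1\right)$$ be the upward unit normal to the graph of $u_i$, and let $\mathbf e_2=(0,1,0)$. Suppose that there are $x_0\in\mathbb R$ and $\epsilon>0$ such that, for $i=1,2$, $\nu_i(x,y)\cdot\mathbf e_2>\epsilon$ for all $(x,y)\in\Omega$ with $x\ge x_0$. Then $u_2-u_1\equiv d$ on $\Omega$. -/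

import Mathlib

namespace Translator

/-- The Euclidean plane, with coordinates `x = p 0` and `y = p 1`. -/
abbrev Plane : Type := EuclideanSpace ℝ (Fin 2)

/-- Euclidean three-space. -/
abbrev Space : Type := EuclideanSpace ℝ (Fin 3)

/-- The half-strip `[a, ∞) × (b, c)`. -/
def halfStrip (a b c : ℝ) : Set Plane :=
  {p | a ≤ p 0 ∧ b < p 1 ∧ p 1 < c}

/-- The divergence of a planar vector field: `∂F₀/∂x + ∂F₁/∂y`. -/
noncomputable def divergence (F : Plane → Plane) (p : Plane) : ℝ :=
  ∑ i : Fin 2, (fderiv ℝ F p (EuclideanSpace.single i 1)) i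

/-- The area element `√(1 + |Du|²)` of the graph of `u`. -/
noncomputable def areaElement (u : Plane → ℝ) (p : Plane) : ℝ :=
  √(1 + ‖gradient u p‖ ^ 2)

/-- The upward unit normal `(-∂u/∂x, -∂u/∂y, 1) / √(1 + |Du|²)` to the graph of `u`
at the point `(p, u p)`. -/
noncomputable def upwardNormal (u : Plane → ℝ) (p : Plane) : Space :=
  (areaElement u p)⁻¹ • !₂[-(gradient u p 0), -(gradient u p 1), 1]

/-- The second standard basis vector of three-space. -/
noncomputable def e₂ : Space := EuclideanSpace.single 1 1

/-- `u` is a (classical) solution on the open set `Ω` of the translator equation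
`Div (Du / √(1 + |Du|²)) = - 1 / √(1 + |Du|²)`. -/
structure IsSolution (Ω : Set Plane) (u : Plane → ℝ) : Prop where
  contDiffOn : ContDiffOn ℝ 2 u Ω
  equation : ∀ p ∈ Ω,
    divergence (fun q => (areaElement u q)⁻¹ • gradient u q) p = -(1 / areaElement u p)

end Translator

/-! By symmetry it suffices to show `u₂ - u₁ ≤ d`. On an unbounded domain the supremum of `u₂ - u₁`
may a priori escape to infinity; the strong maximum principle alone
(`not_isLocalMax_sub_of_leftmost`) only excludes a value above `d` that is attained as a maximum.

Rotation about the corner `o = (a, b)` restores compactness. Rotations preserve the translator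
equation. Far from `o` the strip looks thin, so counterclockwise rotation moves points nearly in the
direction `e₂`, and the hypothesis on the normals makes both functions decrease along such arcs. Let
`M > d` be the maximum of `u₂ - u₁` over the part of the closure within distance `r` of `o`. If `M`
were exceeded further out, a small rotation `R_θ` would still give `u₂ (R_θ p) - u₁ p > M`. An arc
of angle at least `θ₀ > 0` inside the strip starts in a bounded region, so the admissible pairs `(p,
θ)` form a compact set (`isCompact_arcSet`). Monotonicity keeps the whole arc where `u₂ - u₁ > M`,
away from the boundary of `Ω`. At the largest admissible angle, `u₂ ∘ R_θ - u₁` therefore has an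
interior local maximum, which the strong maximum principle forbids (`arcSet_eq_empty`). Hence `M` is
a global maximum, attained inside `Ω`, and the same principle gives the final contradiction. -/

namespace Translator
open Filter Topology

/-! ### The equation in non-divergence form -/

/-- The standard basis of the plane. -/
noncomputable abbrev basisVec (i : Fin 2) : Plane := EuclideanSpace.single i 1

/-- The gradient of `u`, rotated by a quarter turn clockwise. -/
noncomputable def conormal (u : Plane → ℝ) (p : Plane) : Plane :=
  !₂[fderiv ℝ u p (basisVec 1), -fderiv ℝ u p (basisVec 0)]

/-- The non-divergence form `Δu + D²u(n, n) = -(1 + |n|²)`, with `n` the rotated gradient, of the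
translator equation. -/
structure SolvesAt (u : Plane → ℝ) (p : Plane) : Prop where
  contDiffAt : ContDiffAt ℝ 2 u p
  equation : fderiv ℝ (fderiv ℝ u) p (basisVec 0) (basisVec 0)
    + fderiv ℝ (fderiv ℝ u) p (basisVec 1) (basisVec 1)
    + fderiv ℝ (fderiv ℝ u) p (conormal u p) (conormal u p) = -(1 + ‖conormal u p‖ ^ 2)

theorem eq_smul_basisVec (v : Plane) : v = v 0 • basisVec 0 + v 1 • basisVec 1 := by
  ext i; fin_cases i <;> simp [basisVec]

theorem norm_sq_eq (v : Plane) : ‖v‖ ^ 2 = v 0 ^ 2 + v 1 ^ 2 := by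
  simp [EuclideanSpace.norm_sq_eq]

theorem norm_conormal_sq (u : Plane → ℝ) (p : Plane) :
    ‖conormal u p‖ ^ 2 = fderiv ℝ u p (basisVec 0) ^ 2 + fderiv ℝ u p (basisVec 1) ^ 2 := by
  rw [norm_sq_eq]; simp [conormal]; ring

theorem gradient_apply (u : Plane → ℝ) (p : Plane) (i : Fin 2) :
    gradient u p i = fderiv ℝ u p (basisVec i) := by
  have := InnerProductSpace.toDual_symm_apply (𝕜 := ℝ) (x := basisVec i) (y := fderiv ℝ u p)
  rw [← this, gradient, basisVec, EuclideanSpace.inner_single_right]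
  simp

theorem areaElement_eq (u : Plane → ℝ) (p : Plane) : areaElement u p =
    √(1 + (fderiv ℝ u p (basisVec 0) ^ 2 + fderiv ℝ u p (basisVec 1) ^ 2)) := by
  rw [areaElement, norm_sq_eq, gradient_apply, gradient_apply]

theorem areaElement_pos (u : Plane → ℝ) (p : Plane) : 0 < areaElement u p := by
  rw [areaElement]; positivity

theorem areaElement_sq (u : Plane → ℝ) (p : Plane) : areaElement u p ^ 2 =
    1 + (fderiv ℝ u p (basisVec 0) ^ 2 + fderiv ℝ u p (basisVec 1) ^ 2) := by
  rw [areaElement_eq, Real.sq_sqrt (by positivity)]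

theorem hasFDerivAt_fderiv {u : Plane → ℝ} {p : Plane} (hu : ContDiffAt ℝ 2 u p) :
    HasFDerivAt (fderiv ℝ u) (fderiv ℝ (fderiv ℝ u) p) p :=
  ((hu.fderiv_right (m := 1) le_rfl).differentiableAt one_ne_zero).hasFDerivAt

theorem hasFDerivAt_fderiv_apply {u : Plane → ℝ} {p : Plane} (hu : ContDiffAt ℝ 2 u p)
    (v : Plane) : HasFDerivAt (fun q => fderiv ℝ u q v)
      ((fderiv ℝ (fderiv ℝ u) p).flip v) p := by
  simpa using (hasFDerivAt_fderiv hu).clm_apply (hasFDerivAt_const v p)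

theorem snd_fderiv_symm {u : Plane → ℝ} {p : Plane} (hu : ContDiffAt ℝ 2 u p) (v w : Plane) :
    fderiv ℝ (fderiv ℝ u) p v w = fderiv ℝ (fderiv ℝ u) p w v :=
  (hu.isSymmSndFDerivAt (by simp)).eq v w

theorem hasFDerivAt_areaElement {u : Plane → ℝ} {p : Plane} (hu : ContDiffAt ℝ 2 u p) :
    HasFDerivAt (areaElement u) ((areaElement u p)⁻¹ •
      (fderiv ℝ u p (basisVec 0) • (fderiv ℝ (fderiv ℝ u) p).flip (basisVec 0)
        + fderiv ℝ u p (basisVec 1) • (fderiv ℝ (fderiv ℝ u) p).flip (basisVec 1))) p := by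
  have h0 := hasFDerivAt_fderiv_apply hu (basisVec 0)
  have h1 := hasFDerivAt_fderiv_apply hu (basisVec 1)
  have h := (((h0.pow 2).fun_add (h1.pow 2)).const_add 1).sqrt (by positivity)
  have he : areaElement u = fun q =>
    √(1 + (fderiv ℝ u q (basisVec 0) ^ 2 + fderiv ℝ u q (basisVec 1) ^ 2)) :=
    funext fun q => areaElement_eq u q
  rw [he]
  refine h.congr_fderiv ?_
  ext v
  simp
  field_simp

theorem hasFDerivAt_normalized_partial {u : Plane → ℝ} {p : Plane} (hu : ContDiffAt ℝ 2 u p)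
    (i : Fin 2) : HasFDerivAt (fun q => (areaElement u q)⁻¹ * fderiv ℝ u q (basisVec i))
      ((areaElement u p)⁻¹ • (fderiv ℝ (fderiv ℝ u) p).flip (basisVec i) -
        (fderiv ℝ u p (basisVec i) * (areaElement u p)⁻¹ ^ 3) •
      (fderiv ℝ u p (basisVec 0) • (fderiv ℝ (fderiv ℝ u) p).flip (basisVec 0)
        + fderiv ℝ u p (basisVec 1) • (fderiv ℝ (fderiv ℝ u) p).flip (basisVec 1))) p := by
  have hW := areaElement_pos u p
  have h := ((hasDerivAt_inv hW.ne').comp_hasFDerivAt p (hasFDerivAt_areaElement hu)).fun_mul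
      (hasFDerivAt_fderiv_apply hu (basisVec i))
  refine h.congr_fderiv ?_
  ext v
  simp
  field_simp
  ring

theorem fderiv_apply_coord {F : Plane → Plane} {p : Plane} (hF : DifferentiableAt ℝ F p)
    (v : Plane) (i : Fin 2) : fderiv ℝ F p v i = fderiv ℝ (fun q => F q i) p v := by
  have := ((EuclideanSpace.proj i : Plane →L[ℝ] ℝ).hasFDerivAt.comp p
    hF.hasFDerivAt).fderiv
  have h2 := congrArg (fun T => T v) this
  simpa [Function.comp_def] using h2.symm

/-- Expanding the divergence and clearing the area element leaves `(1 + u_y²) u_xx - 2 u_x u_y u_xy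
+ (1 + u_x²) u_yy`, which is `Δu + D²u(n, n)` for `n = (u_y, -u_x)`. -/
theorem IsSolution.solvesAt {Ω : Set Plane} (hΩ : IsOpen Ω) {u : Plane → ℝ}
    (hu : IsSolution Ω u) {p : Plane} (hp : p ∈ Ω) : SolvesAt u p := by
  have hc : ContDiffAt ℝ 2 u p := hu.contDiffOn.contDiffAt (hΩ.mem_nhds hp)
  refine ⟨hc, ?_⟩
  have hW := areaElement_pos u p
  have hW2 := areaElement_sq u p
  have hcoord : ∀ i, (fun q => ((areaElement u q)⁻¹ • gradient u q) i) =
      fun q => (areaElement u q)⁻¹ * fderiv ℝ u q (basisVec i) := fun i => by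
    funext q
    simp [gradient_apply]
  have hF : DifferentiableAt ℝ (fun q => (areaElement u q)⁻¹ • gradient u q) p := by
    rw [differentiableAt_euclidean]
    intro i
    rw [hcoord]
    exact (hasFDerivAt_normalized_partial hc i).differentiableAt
  have heq := hu.equation p hp
  simp only [divergence, Fin.sum_univ_two, fderiv_apply_coord hF, hcoord,
    (hasFDerivAt_normalized_partial hc _).fderiv] at heq
  rw [norm_conormal_sq]
  have hn : conormal u p = fderiv ℝ u p (basisVec 1) • basisVec 0
      + (-fderiv ℝ u p (basisVec 0)) • basisVec 1 := by
    conv_lhs => rw [eq_smul_basisVec (conormal u p)]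
    simp [conormal]
  rw [hn]
  have hs := snd_fderiv_symm hc (basisVec 1) (basisVec 0)
  simp only [map_add, map_smul, add_apply, smul_apply,
    sub_apply, ContinuousLinearMap.flip_apply, smul_eq_mul] at heq ⊢
  rw [hs] at heq ⊢
  generalize areaElement u p = W at *
  generalize fderiv ℝ u p (basisVec 0) = x at *
  generalize fderiv ℝ u p (basisVec 1) = y at *
  generalize fderiv ℝ (fderiv ℝ u) p (basisVec 0) (basisVec 0) = r at *
  generalize fderiv ℝ (fderiv ℝ u) p (basisVec 0) (basisVec 1) = s at *
  generalize fderiv ℝ (fderiv ℝ u) p (basisVec 1) (basisVec 1) = t at *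
  field_simp at heq
  linear_combination heq - (r + t + 1) * hW2

/-! ### Strong maximum principle by a Gaussian barrier -/

/-- Were the second derivative along `v` positive, the restriction to that line would have a local
minimum as well as a local maximum, so it would be locally constant, with second derivative zero. -/
theorem snd_fderiv_nonpos_of_isLocalMax {f : Plane → ℝ} {f' : Plane → Plane →L[ℝ] ℝ}
    {f'' : Plane →L[ℝ] Plane →L[ℝ] ℝ} {q : Plane}
    (hf : ∀ᶠ x in 𝓝 q, HasFDerivAt f (f' x) x) (hf' : HasFDerivAt f' f'' q)
    (hmax : IsLocalMax f q) (v : Plane) : f'' v v ≤ 0 := by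
  by_contra! hpos
  set g : ℝ → ℝ := fun t => f (q + t • v) with hg
  have hline : ∀ t : ℝ, HasDerivAt (fun t : ℝ => q + t • v) v t := fun t => by
    simpa using ((hasDerivAt_id t).smul_const v).const_add q
  have htend : Tendsto (fun t : ℝ => q + t • v) (𝓝 0) (𝓝 q) := by
    have := (hline 0).continuousAt.tendsto
    simpa using this
  have h1 : ∀ᶠ t in 𝓝 (0 : ℝ), HasDerivAt g (f' (q + t • v) v) t := by
    filter_upwards [htend.eventually hf] with t ht
    exact HasFDerivAt.comp_hasDerivAt (f := fun t : ℝ => q + t • v) t ht (hline t)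
  have h2 : deriv g =ᶠ[𝓝 0] fun t => f' (q + t • v) v := h1.mono fun t ht => ht.deriv
  have h3 : HasDerivAt (fun t : ℝ => f' (q + t • v) v) (f'' v v) 0 := by
    have hq : HasFDerivAt f' f'' (q + (0 : ℝ) • v) := by simpa using hf'
    have := (HasFDerivAt.comp_hasDerivAt (f := fun t : ℝ => q + t • v) (0 : ℝ) hq (hline 0)).clm_apply (hasDerivAt_const (0 : ℝ) v)
    simpa using this
  have h4 : deriv (deriv g) 0 = f'' v v := by rw [h2.deriv_eq, h3.deriv]
  have hgmax : IsLocalMax g 0 := by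
    have : ∀ᶠ t in 𝓝 (0 : ℝ), f (q + t • v) ≤ f q := htend.eventually hmax
    simpa [IsLocalMax, IsMaxFilter, hg] using this
  have hgmin : IsLocalMin g 0 := isLocalMin_of_deriv_deriv_pos (h4 ▸ hpos)
    hgmax.deriv_eq_zero h1.self_of_nhds.continuousAt
  have hconst : g =ᶠ[𝓝 0] fun _ => g 0 := by
    filter_upwards [hgmax, hgmin] with t ht ht' using le_antisymm ht ht'
  have h5 : deriv g =ᶠ[𝓝 0] fun _ => (0 : ℝ) := by
    filter_upwards [hconst.deriv] with t ht
    simpa using ht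
  rw [← h4, h5.deriv_eq] at hpos
  simp at hpos

/-- The Euclidean inner product as a real bilinear form. -/
noncomputable def innerForm : Plane →L[ℝ] Plane →L[ℝ] ℝ := innerSL ℝ

@[simp] theorem innerForm_apply (v w : Plane) : innerForm v w = inner ℝ v w := rfl

/-- The Gaussian barrier centred at `z`. -/
noncomputable def gaussian (α : ℝ) (z x : Plane) : ℝ := Real.exp (-α * ‖x - z‖ ^ 2)

theorem hasFDerivAt_gaussian (α : ℝ) (z x : Plane) :
    HasFDerivAt (gaussian α z) ((-2 * α * gaussian α z x) • innerForm (x - z)) x := by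
  have h := (((hasStrictFDerivAt_norm_sq (x - z)).hasFDerivAt.comp x
    ((hasFDerivAt_id x).sub_const z)).const_mul (-α)).exp
  refine h.congr_fderiv ?_
  ext v
  simp [gaussian]
  ring

theorem hasFDerivAt_fderiv_gaussian (α : ℝ) (z x : Plane) :
    HasFDerivAt (fun x => (-2 * α * gaussian α z x) • innerForm (x - z))
      ((-2 * α * gaussian α z x) • innerForm +
        ((-2 * α) • ((-2 * α * gaussian α z x) • (innerForm (x - z)))).smulRight
          (innerForm (x - z))) x := by
  exact ((hasFDerivAt_gaussian α z x).const_mul (-2 * α)).smul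
    (innerForm.hasFDerivAt.comp x ((hasFDerivAt_id x).sub_const z))

/-- At an interior maximum of `v - u + η ψ`, with `ψ` a Gaussian barrier, the barrier is not too
steep. -/
theorem SolvesAt.barrier_bound {u v : Plane → ℝ} {q z : Plane} {α η G K : ℝ}
    (hα : 0 < α) (hη : 0 < η) (hu : SolvesAt u q) (hv : SolvesAt v q)
    (hu2 : ∀ᶠ x in 𝓝 q, DifferentiableAt ℝ u x) (hv2 : ∀ᶠ x in 𝓝 q, DifferentiableAt ℝ v x)
    (hGu : ‖conormal u q‖ ≤ G) (hGv : ‖conormal v q‖ ≤ G)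
    (hK : ‖fderiv ℝ (fderiv ℝ u) q‖ ≤ K)
    (hmax : IsLocalMax (fun x => v x - u x + η * gaussian α z x) q) :
    2 * α * ‖q - z‖ ^ 2 ≤ 2 + G ^ 2 + 2 * G * (K + 1) * ‖q - z‖ := by
  have hder : ∀ᶠ x in 𝓝 q, HasFDerivAt (fun x => v x - u x + η * gaussian α z x)
      (fderiv ℝ v x - fderiv ℝ u x + η • ((-2 * α * gaussian α z x) • innerForm (x - z))) x := by
    filter_upwards [hu2, hv2] with x hux hvx
    exact (hvx.hasFDerivAt.sub hux.hasFDerivAt).add ((hasFDerivAt_gaussian α z x).const_mul η)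
  have hder2 := ((hasFDerivAt_fderiv hv.contDiffAt).sub (hasFDerivAt_fderiv hu.contDiffAt)).add
    ((hasFDerivAt_fderiv_gaussian α z q).const_smul η)
  have h2 := snd_fderiv_nonpos_of_isLocalMax hder hder2 hmax
  have h1 : fderiv ℝ v q - fderiv ℝ u q +
      η • ((-2 * α * gaussian α z q) • innerForm (q - z)) = 0 :=
    hmax.hasFDerivAt_eq_zero hder.self_of_nhds
  set ψ := gaussian α z q with hψ
  have hψ0 : 0 < ψ := Real.exp_pos _
  set ξ := q - z with hξ
  set κ := 2 * α * η * ψ with hκ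
  have hκ0 : 0 < κ := by positivity
  -- The first-order condition makes the gradients differ by `κ ξ`. Every error term below then
  -- carries the factor `κ`, which cancels at the end whatever the size of `η`.
  have hD : ∀ e, fderiv ℝ v q e = fderiv ℝ u q e + κ * inner ℝ ξ e := fun e => by
    have := congrArg (fun T => T e) h1
    simp at this
    rw [hκ]; linarith
  set U := fderiv ℝ (fderiv ℝ u) q with hU
  set V := fderiv ℝ (fderiv ℝ v) q with hV
  have hDD : ∀ e, V e e - U e e ≤ κ * (‖e‖ ^ 2 - 2 * α * inner ℝ ξ e ^ 2) := fun e => by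
    have := h2 e
    simp only [add_apply, sub_apply, smul_apply, ContinuousLinearMap.smulRight_apply,
      innerForm_apply, smul_eq_mul, real_inner_self_eq_norm_sq] at this
    rw [hκ]; linarith
  set m := conormal u q with hm
  set n := conormal v q with hn
  set J : Plane := !₂[ξ 1, -ξ 0] with hJ
  have hin0 : inner ℝ ξ (basisVec 0) = ξ 0 := by simp [basisVec, EuclideanSpace.inner_single_right]
  have hin1 : inner ℝ ξ (basisVec 1) = ξ 1 := by simp [basisVec, EuclideanSpace.inner_single_right]
  have hnm : n = m + κ • J := by
    ext i
    fin_cases i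
    · simp [hn, hm, hJ, conormal, hD, hin1]
    · simp [hn, hm, hJ, conormal, hD, hin0]; ring
  have hJn : ‖J‖ = ‖ξ‖ := by
    have : ‖J‖ ^ 2 = ‖ξ‖ ^ 2 := by
      rw [norm_sq_eq, norm_sq_eq]; simp [hJ]; ring
    exact (sq_eq_sq₀ (norm_nonneg _) (norm_nonneg _)).1 this
  have hξ2 := norm_sq_eq ξ
  have hG0 : 0 ≤ G := (norm_nonneg _).trans hGu
  have hK0 : 0 ≤ K := (norm_nonneg U).trans hK
  have hbil : U n n - U m m = κ * U J (n + m) := by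
    have hs := snd_fderiv_symm hu.contDiffAt J m
    rw [hnm]
    simp only [map_add, map_smul, add_apply, smul_apply, smul_eq_mul]
    rw [← hU] at hs
    rw [hs]; ring
  have hsum : ‖n + m‖ ≤ 2 * G := (norm_add_le _ _).trans (by linarith)
  have hb1 : |U J (n + m)| ≤ K * ‖ξ‖ * (2 * G) := by
    have h := U.le_opNorm₂ J (n + m)
    rw [hJn] at h
    refine h.trans ?_
    gcongr
  have hnsq : ‖n‖ ^ 2 - ‖m‖ ^ 2 = κ * inner ℝ J (n + m) := by
    rw [← real_inner_self_eq_norm_sq, ← real_inner_self_eq_norm_sq, hnm]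
    simp only [inner_add_left, inner_add_right, inner_smul_left, inner_smul_right,
      real_inner_comm m J]
    simp; ring
  have hb2 : |inner ℝ J (n + m)| ≤ ‖ξ‖ * (2 * G) := by
    refine (abs_real_inner_le_norm _ _).trans ?_
    rw [hJn]
    gcongr
  have e0 := hDD (basisVec 0)
  have e1 := hDD (basisVec 1)
  have en := hDD n
  have hu' := hu.equation
  have hv' := hv.equation
  rw [← hm, ← hU] at hu'
  rw [← hn, ← hV] at hv'
  rw [hin0] at e0
  rw [hin1] at e1
  have hb0 : ‖(basisVec 0 : Plane)‖ = 1 := by simp [basisVec]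
  have hb1' : ‖(basisVec 1 : Plane)‖ = 1 := by simp [basisVec]
  rw [hb0] at e0
  rw [hb1'] at e1
  have hb1l := (abs_le.1 hb1).2
  have hb2l := (abs_le.1 hb2).2
  have hn2 : ‖n‖ ^ 2 ≤ G ^ 2 := by gcongr
  have hin : 0 ≤ 2 * α * inner ℝ ξ n ^ 2 := by positivity
  -- Subtract the two equations, splitting `V n n - U m m` as `(V - U) n n + (U n n - U m m)`, and
  -- apply `hDD` to both basis vectors and to `n`.
  have key : κ * (2 * α * ‖ξ‖ ^ 2) ≤ κ * (2 + G ^ 2 + 2 * G * (K + 1) * ‖ξ‖) := by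
    have k1 := mul_le_mul_of_nonneg_left hb1l hκ0.le
    have k2 := mul_le_mul_of_nonneg_left hb2l hκ0.le
    have k3 := mul_le_mul_of_nonneg_left hn2 hκ0.le
    have k4 := mul_nonneg hκ0.le hin
    rw [hξ2]
    linarith
  exact le_of_mul_le_mul_left key hκ0

theorem eventually_conormal_le {u : Plane → ℝ} {p : Plane} (hu : ContDiffAt ℝ 2 u p) :
    ∀ᶠ q in 𝓝 p, ‖conormal u q‖ ≤ ‖conormal u p‖ + 1 := by
  have h : ∀ v, ContinuousAt (fun q => fderiv ℝ u q v) p := fun v =>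
    (hasFDerivAt_fderiv_apply hu v).continuousAt
  have hc : ContinuousAt (fun q => ‖conormal u q‖ ^ 2) p := by
    simp_rw [norm_conormal_sq]
    exact ((h _).pow 2).add ((h _).pow 2)
  have hlt : ‖conormal u p‖ ^ 2 < (‖conormal u p‖ + 1) ^ 2 := by
    have := norm_nonneg (conormal u p)
    nlinarith
  filter_upwards [hc.eventually_lt_const hlt] with q hq
  exact (le_abs_self _).trans (abs_le_of_sq_le_sq hq.le (by positivity))

theorem eventually_snd_fderiv_le {u : Plane → ℝ} {p : Plane} (hu : ContDiffAt ℝ 2 u p) :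
    ∀ᶠ q in 𝓝 p, ‖fderiv ℝ (fderiv ℝ u) q‖ ≤ ‖fderiv ℝ (fderiv ℝ u) p‖ + 1 := by
  have h : ContinuousAt (fderiv ℝ (fderiv ℝ u)) p :=
    ((hu.fderiv_right (m := 1) le_rfl).fderiv_right (m := 0) le_rfl).continuousAt
  have hn : ContinuousAt (fun q => ‖fderiv ℝ (fderiv ℝ u) q‖) p :=
    ContinuousAt.comp (g := fun T : Plane →L[ℝ] Plane →L[ℝ] ℝ => ‖T‖)
      (continuous_norm (E := Plane →L[ℝ] Plane →L[ℝ] ℝ)).continuousAt h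
  filter_upwards [hn.eventually_lt_const (lt_add_one _)] with q hq using hq.le

/-- The ball is tangent at `p` to the vertical line through `p`, from the left. -/
theorem eq_of_mem_closedBall_sub {p q : Plane} {ρ : ℝ}
    (hq : q ∈ Metric.closedBall (p - ρ • basisVec 0) ρ) (h : p 0 ≤ q 0) (hρ : 0 < ρ) : q = p := by
  rw [Metric.mem_closedBall, dist_eq_norm] at hq
  have h2 : ‖q - (p - ρ • basisVec 0)‖ ^ 2 ≤ ρ ^ 2 := by gcongr
  rw [norm_sq_eq] at h2
  simp [basisVec] at h2
  have h0 : q 0 = p 0 := by nlinarith [sq_nonneg (q 0 - p 0), sq_nonneg (q 1 - p 1)]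
  have h1 : q 1 = p 1 := by
    have : (q 1 - p 1) ^ 2 ≤ 0 := by rw [h0] at h2; nlinarith
    have := pow_eq_zero_iff (two_ne_zero) |>.1 (le_antisymm this (sq_nonneg _))
    linarith
  ext i
  fin_cases i
  · exact h0
  · exact h1

/-- Strong maximum principle: the difference of two solutions has no local maximum at a point
that is leftmost among the nearby points where the maximum is attained. -/
theorem not_isLocalMax_sub_of_leftmost {u v : Plane → ℝ} {p : Plane}
    (hsol : ∀ᶠ q in 𝓝 p, SolvesAt u q ∧ SolvesAt v q)
    (hmax : ∀ᶠ q in 𝓝 p, v q - u q ≤ v p - u p)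
    (hleft : ∀ᶠ q in 𝓝 p, v q - u q = v p - u p → p 0 ≤ q 0) : False := by
  obtain ⟨hup, hvp⟩ := hsol.self_of_nhds
  set G := max (‖conormal u p‖ + 1) (‖conormal v p‖ + 1) with hG
  set K := ‖fderiv ℝ (fderiv ℝ u) p‖ + 1 with hK
  have hall := hsol.and (hmax.and (hleft.and ((eventually_conormal_le hup.contDiffAt).and
    ((eventually_conormal_le hvp.contDiffAt).and (eventually_snd_fderiv_le hup.contDiffAt)))))
  obtain ⟨ρ, hρ, hball⟩ := Metric.nhds_basis_closedBall.eventually_iff.1 hall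
  have hG1 : 1 ≤ G := le_max_of_le_left (by linarith [norm_nonneg (conormal u p)])
  have hK1 : 1 ≤ K := by linarith [norm_nonneg (fderiv ℝ (fderiv ℝ u) p)]
  set z := p - ρ • basisVec 0 with hz
  have hpz : ‖p - z‖ = ρ := by
    simp [hz, basisVec, norm_smul, abs_of_pos hρ]
  -- Chosen so that `barrier_bound` fails by 1 whenever `ρ / 2 ≤ ‖q - z‖ ≤ 2 * ρ`.
  set α := (2 + G ^ 2 + 2 * G * (K + 1) * (2 * ρ) + 1) / (2 * (ρ / 2) ^ 2) with hα
  have hα0 : 0 < α := by positivity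
  have hα1 : 2 * α * (ρ / 2) ^ 2 = 2 + G ^ 2 + 2 * G * (K + 1) * (2 * ρ) + 1 := by
    rw [hα]; field_simp
  have hsub : Metric.closedBall p (ρ / 2) ⊆ Metric.closedBall p ρ :=
    Metric.closedBall_subset_closedBall (by linarith)
  have hcont : ContinuousOn (fun x => v x - u x) (Metric.closedBall p (ρ / 2)) := fun x hx =>
    ((hball (hsub hx)).1.2.contDiffAt.continuousAt.sub
      (hball (hsub hx)).1.1.contDiffAt.continuousAt).continuousWithinAt
  -- A uniform gap on the part of the small sphere inside the barrier ball
  obtain ⟨m, hmlt, hm⟩ : ∃ m < v p - u p, ∀ q ∈ Metric.sphere p (ρ / 2) ∩ Metric.closedBall z ρ,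
      v q - u q ≤ m := by
    have hcpt : IsCompact (Metric.sphere p (ρ / 2) ∩ Metric.closedBall z ρ) :=
      (isCompact_sphere _ _).inter_right Metric.isClosed_closedBall
    rcases (Metric.sphere p (ρ / 2) ∩ Metric.closedBall z ρ).eq_empty_or_nonempty with he | hne
    · exact ⟨v p - u p - 1, by linarith, by simp [he]⟩
    · obtain ⟨q, hq, hqmax⟩ := hcpt.exists_isMaxOn hne
        (hcont.mono (Set.inter_subset_left.trans Metric.sphere_subset_closedBall))
      refine ⟨v q - u q, ?_, fun x hx => hqmax hx⟩
      have hb := hball (hsub (Metric.sphere_subset_closedBall hq.1))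
      refine lt_of_le_of_ne hb.2.1 fun heq => ?_
      have := eq_of_mem_closedBall_sub hq.2 (hb.2.2.1 heq) hρ
      have hd := hq.1
      rw [this, Metric.mem_sphere, dist_self] at hd
      linarith
  -- Half the gap: since the Gaussian is at most 1, the perturbation cannot bring the part of the
  -- sphere inside the barrier ball up to the value at `p`.
  set η := (v p - u p - m) / 2 with hη
  have hη0 : 0 < η := by rw [hη]; linarith
  have hgle : ∀ x, gaussian α z x ≤ 1 := fun x => by
    rw [gaussian, Real.exp_le_one_iff]
    have : 0 ≤ α * ‖x - z‖ ^ 2 := by positivity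
    linarith
  have hgpos : 0 < gaussian α z p := Real.exp_pos _
  obtain ⟨q, hq, hqmax⟩ := (isCompact_closedBall p (ρ / 2)).exists_isMaxOn
    ⟨p, Metric.mem_closedBall_self (by linarith)⟩
    (hcont.add (f := fun x => v x - u x) (g := fun x => η * gaussian α z x)
      (continuous_const.mul (continuous_iff_continuousAt.2 fun x =>
        (hasFDerivAt_gaussian α z x).continuousAt)).continuousOn)
  have hqp : v p - u p + η * gaussian α z p ≤ v q - u q + η * gaussian α z q :=
    hqmax (Metric.mem_closedBall_self (by linarith))
  have hb := hball (hsub hq)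
  have hint : q ∈ Metric.ball p (ρ / 2) := by
    rw [Metric.mem_ball]
    refine lt_of_le_of_ne (Metric.mem_closedBall.1 hq) fun hsph => ?_
    -- On the sphere, the gap wins inside the barrier ball; outside it the Gaussian is smaller than
    -- at `p`, and `v - u` is no larger.
    by_cases hqz : q ∈ Metric.closedBall z ρ
    · have h1 := hm q ⟨hsph, hqz⟩
      have h2 := mul_le_mul_of_nonneg_left (hgle q) hη0.le
      have h3 := mul_pos hη0 hgpos
      linarith
    · rw [Metric.mem_closedBall, dist_eq_norm, not_le, ← hpz] at hqz
      have h1 : gaussian α z q < gaussian α z p := by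
        rw [gaussian, gaussian, Real.exp_lt_exp]
        have : ‖p - z‖ ^ 2 < ‖q - z‖ ^ 2 := by gcongr
        have := mul_lt_mul_of_pos_left this hα0
        linarith
      have h2 := mul_lt_mul_of_pos_left h1 hη0
      linarith [hb.2.1]
  have hnear : ∀ᶠ x in 𝓝 q, x ∈ Metric.ball p (ρ / 2) := Metric.isOpen_ball.mem_nhds hint
  have hmem : ∀ x ∈ Metric.ball p (ρ / 2), x ∈ Metric.closedBall p ρ := fun x hx =>
    hsub (Metric.ball_subset_closedBall hx)
  have hbound := SolvesAt.barrier_bound (z := z) hα0 hη0 hb.1.1 hb.1.2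
    (hnear.mono fun x hx => (hball (hmem x hx)).1.1.contDiffAt.differentiableAt two_ne_zero)
    (hnear.mono fun x hx => (hball (hmem x hx)).1.2.contDiffAt.differentiableAt two_ne_zero)
    (hb.2.2.2.1.trans (le_max_left _ _)) (hb.2.2.2.2.1.trans (le_max_right _ _)) hb.2.2.2.2.2
    (hnear.mono fun x hx => hqmax (Metric.ball_subset_closedBall hx))
  rw [Metric.mem_ball, dist_eq_norm] at hint
  have hlow : ρ / 2 ≤ ‖q - z‖ := by
    have h := norm_sub_norm_le (p - z) (p - q)
    rw [hpz, norm_sub_rev p q, sub_sub_sub_cancel_left] at h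
    linarith
  have hupp : ‖q - z‖ ≤ 2 * ρ := by
    have h := norm_add_le (q - p) (p - z)
    rw [hpz, sub_add_sub_cancel] at h
    linarith
  have h1 : 2 * α * (ρ / 2) ^ 2 ≤ 2 * α * ‖q - z‖ ^ 2 := by gcongr
  have h2 : 2 * G * (K + 1) * ‖q - z‖ ≤ 2 * G * (K + 1) * (2 * ρ) := by gcongr
  linarith

/-! ### Rotations and invariance of the equation -/

/-- The counterclockwise quarter turn of the plane. -/
noncomputable def quarterTurn : Plane →L[ℝ] Plane :=
  (EuclideanSpace.proj 0 : Plane →L[ℝ] ℝ).smulRight (basisVec 1)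
    - (EuclideanSpace.proj 1 : Plane →L[ℝ] ℝ).smulRight (basisVec 0)

@[simp] theorem quarterTurn_apply_zero (v : Plane) : quarterTurn v 0 = -v 1 := by
  simp [quarterTurn, basisVec]

@[simp] theorem quarterTurn_apply_one (v : Plane) : quarterTurn v 1 = v 0 := by
  simp [quarterTurn, basisVec]

/-- The linear rotation by the angle `θ`. -/
noncomputable def linearRotation (θ : ℝ) : Plane →L[ℝ] Plane :=
  Real.cos θ • ContinuousLinearMap.id ℝ Plane + Real.sin θ • quarterTurn

@[simp] theorem linearRotation_apply_zero (θ : ℝ) (v : Plane) :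
    linearRotation θ v 0 = Real.cos θ * v 0 - Real.sin θ * v 1 := by
  simp [linearRotation]; ring

@[simp] theorem linearRotation_apply_one (θ : ℝ) (v : Plane) :
    linearRotation θ v 1 = Real.cos θ * v 1 + Real.sin θ * v 0 := by
  simp [linearRotation]

/-- The rotation by the angle `θ` about the point `o`. -/
noncomputable def rotation (o : Plane) (θ : ℝ) (p : Plane) : Plane :=
  o + linearRotation θ (p - o)

theorem rotation_sub (o : Plane) (θ : ℝ) (p : Plane) :
    rotation o θ p - o = linearRotation θ (p - o) := by simp [rotation]

@[simp] theorem rotation_zero (o p : Plane) : rotation o 0 p = p := by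
  simp [rotation, linearRotation]

theorem norm_linearRotation (θ : ℝ) (v : Plane) : ‖linearRotation θ v‖ = ‖v‖ := by
  rw [← sq_eq_sq₀ (norm_nonneg _) (norm_nonneg _), norm_sq_eq, norm_sq_eq]
  simp only [linearRotation_apply_zero, linearRotation_apply_one]
  linear_combination (v 0 ^ 2 + v 1 ^ 2) * Real.cos_sq_add_sin_sq θ

theorem norm_rotation_sub (o : Plane) (θ : ℝ) (p : Plane) : ‖rotation o θ p - o‖ = ‖p - o‖ := by
  rw [rotation_sub, norm_linearRotation]

theorem continuous_rotation (o : Plane) :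
    Continuous fun x : Plane × ℝ => rotation o x.2 x.1 := by
  have h : (fun x : Plane × ℝ => rotation o x.2 x.1) = fun x => o + (Real.cos x.2 • (x.1 - o)
    + Real.sin x.2 • quarterTurn (x.1 - o)) := by
    funext x; simp [rotation, linearRotation]
  rw [h]
  fun_prop

theorem hasFDerivAt_rotation (o : Plane) (θ : ℝ) (p : Plane) :
    HasFDerivAt (rotation o θ) (linearRotation θ) p := by
  have h := ((linearRotation θ).hasFDerivAt.comp p ((hasFDerivAt_id p).sub_const o)).const_add o
  exact h

theorem contDiff_rotation (o : Plane) (θ : ℝ) : ContDiff ℝ 2 (rotation o θ) :=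
  contDiff_const.add ((linearRotation θ).contDiff.comp (contDiff_id.sub contDiff_const))

theorem hasDerivAt_rotation (o : Plane) (θ : ℝ) (p : Plane) :
    HasDerivAt (fun t => rotation o t p) (quarterTurn (rotation o θ p - o)) θ := by
  have h : HasDerivAt (fun t => o + (Real.cos t • (p - o) + Real.sin t • quarterTurn (p - o)))
      (-Real.sin θ • (p - o) + Real.cos θ • quarterTurn (p - o)) θ :=
    (((Real.hasDerivAt_cos θ).smul_const _).add ((Real.hasDerivAt_sin θ).smul_const _)).const_add o
  have he : (fun t => rotation o t p) =
      fun t => o + (Real.cos t • (p - o) + Real.sin t • quarterTurn (p - o)) := by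
    funext t; simp [rotation, linearRotation]
  rw [he]
  convert h using 1
  rw [rotation_sub]
  ext i
  fin_cases i <;> simp <;> ring

theorem linearRotation_basisVec_zero (θ : ℝ) : linearRotation θ (basisVec 0) =
    Real.cos θ • basisVec 0 + Real.sin θ • basisVec 1 := by
  ext i; fin_cases i <;> simp [basisVec]

theorem linearRotation_basisVec_one (θ : ℝ) : linearRotation θ (basisVec 1) =
    (-Real.sin θ) • basisVec 0 + Real.cos θ • basisVec 1 := by
  ext i; fin_cases i <;> simp [basisVec]

/-- The Laplacian is a trace, hence rotation invariant, and the rotated gradient transforms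
covariantly (`hrn`). -/
theorem SolvesAt.comp_rotation {u : Plane → ℝ} {o p : Plane} {θ : ℝ}
    (hu : SolvesAt u (rotation o θ p)) : SolvesAt (fun q => u (rotation o θ q)) p := by
  have hcd : ContDiffAt ℝ 2 (fun q => u (rotation o θ q)) p :=
    hu.contDiffAt.comp p (contDiff_rotation o θ).contDiffAt
  refine ⟨hcd, ?_⟩
  have hev : ∀ᶠ q in 𝓝 (rotation o θ p), DifferentiableAt ℝ u q :=
    (hu.contDiffAt.eventually (by simp)).mono fun q hq => hq.differentiableAt two_ne_zero
  have h1 : fderiv ℝ (fun q => u (rotation o θ q)) =ᶠ[𝓝 p]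
      fun q => (fderiv ℝ u (rotation o θ q)).comp (linearRotation θ) := by
    filter_upwards [(hasFDerivAt_rotation o θ p).continuousAt.eventually hev] with q hq
    exact (hq.hasFDerivAt.comp q (hasFDerivAt_rotation o θ q)).fderiv
  have h1p : ∀ v, fderiv ℝ (fun q => u (rotation o θ q)) p v =
      fderiv ℝ u (rotation o θ p) (linearRotation θ v) := fun v => by
    rw [h1.self_of_nhds]; rfl
  have h2 : ∀ v w, fderiv ℝ (fderiv ℝ (fun q => u (rotation o θ q))) p v w =
      fderiv ℝ (fderiv ℝ u) (rotation o θ p) (linearRotation θ v) (linearRotation θ w) := by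
    intro v w
    have hA := (hasFDerivAt_fderiv hu.contDiffAt).comp p (hasFDerivAt_rotation o θ p)
    have hB := hA.clm_comp (hasFDerivAt_const (linearRotation θ) p)
    have hC := hB.congr_of_eventuallyEq h1
    rw [hC.fderiv]
    simp
  set U := fderiv ℝ (fderiv ℝ u) (rotation o θ p) with hU
  set D := fderiv ℝ u (rotation o θ p) with hD
  set n := conormal (fun q => u (rotation o θ q)) p with hn
  have hrn : linearRotation θ n = conormal u (rotation o θ p) := by
    have hcs := Real.cos_sq_add_sin_sq θ
    ext i
    fin_cases i
    · simp [hn, conormal, h1p, linearRotation_basisVec_zero, linearRotation_basisVec_one, ← hD]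
      linear_combination D (basisVec 1) * hcs
    · simp [hn, conormal, h1p, linearRotation_basisVec_zero, linearRotation_basisVec_one, ← hD]
      linear_combination -D (basisVec 0) * hcs
  rw [h2, h2, h2, hrn, ← norm_linearRotation θ n, hrn, ← hu.equation,
    linearRotation_basisVec_zero, linearRotation_basisVec_one]
  simp only [map_add, map_smul, add_apply, smul_apply, smul_eq_mul, ← hU]
  linear_combination (U (basisVec 0) (basisVec 0) + U (basisVec 1) (basisVec 1)) *
    Real.cos_sq_add_sin_sq θ

/-! ### Monotonicity along arcs -/

theorem areaElement_mul_lt_of_upwardNormal {u : Plane → ℝ} {q : Plane} {ε : ℝ}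
    (h : ε < inner ℝ (upwardNormal u q) e₂) :
    areaElement u q * ε < -fderiv ℝ u q (basisVec 1) := by
  have hW := areaElement_pos u q
  have he : inner ℝ (upwardNormal u q) e₂ =
      (areaElement u q)⁻¹ * -fderiv ℝ u q (basisVec 1) := by
    rw [upwardNormal, e₂, EuclideanSpace.inner_single_right]
    simp [gradient_apply]
  rwa [he, inv_mul_eq_div, lt_div_iff₀' hW] at h

/-- With `W` the area element, `|u_x| ≤ W` and `u_y < -ε W`, so the angular derivative `-v₁ u_x + v₀
u_y` is at most `W (v₁ - ε v₀)`. -/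
theorem fderiv_quarterTurn_nonpos {u : Plane → ℝ} {q v : Plane} {ε : ℝ}
    (h : ε < inner ℝ (upwardNormal u q) e₂) (hv0 : 0 ≤ v 0) (hv1 : 0 ≤ v 1)
    (hv : v 1 ≤ ε * v 0) : fderiv ℝ u q (quarterTurn v) ≤ 0 := by
  have hy := areaElement_mul_lt_of_upwardNormal h
  have hW := areaElement_pos u q
  have hx : |fderiv ℝ u q (basisVec 0)| ≤ areaElement u q := by
    refine abs_le_of_sq_le_sq ?_ hW.le
    rw [areaElement_sq]
    nlinarith [sq_nonneg (fderiv ℝ u q (basisVec 1))]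
  rw [eq_smul_basisVec (quarterTurn v)]
  simp only [map_add, map_smul, smul_eq_mul, quarterTurn_apply_zero, quarterTurn_apply_one]
  have h1 := mul_le_mul_of_nonneg_left (abs_le.1 hx).1 hv1
  have h2 := mul_le_mul_of_nonneg_left hy.le hv0
  have h3 := mul_le_mul_of_nonneg_left hv hW.le
  linarith

theorem antitoneOn_rotation {Ω : Set Plane} {u : Plane → ℝ} {o p : Plane} {r θ : ℝ}
    (hdiff : ∀ q ∈ Ω, DifferentiableAt ℝ u q)
    (hanti : ∀ q ∈ Ω, r ≤ ‖q - o‖ → fderiv ℝ u q (quarterTurn (q - o)) ≤ 0)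
    (hr : r ≤ ‖p - o‖) (harc : ∀ t ∈ Set.Icc 0 θ, rotation o t p ∈ Ω) :
    AntitoneOn (fun t => u (rotation o t p)) (Set.Icc 0 θ) := by
  have hder : ∀ t ∈ Set.Icc 0 θ, HasDerivAt (fun t => u (rotation o t p))
      (fderiv ℝ u (rotation o t p) (quarterTurn (rotation o t p - o))) t := fun t ht =>
    HasFDerivAt.comp_hasDerivAt (f := fun t => rotation o t p) t
      (hdiff _ (harc t ht)).hasFDerivAt (hasDerivAt_rotation o t p)
  refine antitoneOn_of_deriv_nonpos (convex_Icc _ _)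
    (fun t ht => (hder t ht).continuousAt.continuousWithinAt)
    (fun t ht => (hder t (interior_subset ht)).differentiableAt.differentiableWithinAt)
    fun t ht => ?_
  rw [(hder t (interior_subset ht)).deriv]
  exact hanti _ (harc t (interior_subset ht)) (by rwa [norm_rotation_sub])

/-! ### Compactness of the set of admissible arcs -/

/-- The setting of the comparison argument: two solutions on a domain in a half-strip with corner
`(a, b)` whose difference is `d` on the boundary, and which decrease under rotation about the corner
at distance at least `r` from it. -/
structure AngularPair (a b c d r : ℝ) (Ω : Set Plane) (u₁ u₂ : Plane → ℝ) : Prop where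
  isOpen : IsOpen Ω
  strip : ∀ q ∈ closure Ω, a ≤ q 0 ∧ b ≤ q 1 ∧ q 1 ≤ c
  solvesAt₁ : ∀ q ∈ Ω, SolvesAt u₁ q
  solvesAt₂ : ∀ q ∈ Ω, SolvesAt u₂ q
  continuousOn₁ : ContinuousOn u₁ (closure Ω)
  continuousOn₂ : ContinuousOn u₂ (closure Ω)
  boundary : ∀ q ∈ frontier Ω, u₂ q - u₁ q = d
  antitone₁ : ∀ q ∈ Ω, r ≤ ‖q - !₂[a, b]‖ → fderiv ℝ u₁ q (quarterTurn (q - !₂[a, b])) ≤ 0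
  antitone₂ : ∀ q ∈ Ω, r ≤ ‖q - !₂[a, b]‖ → fderiv ℝ u₂ q (quarterTurn (q - !₂[a, b])) ≤ 0
  two_mul_width_lt : 2 * (c - b) < r

/-- The pairs `(p, θ)` such that rotating the graph of `u₁` by the angle `θ` and raising it by
`d + k θ` keeps its point above `p` below the graph of `u₂`, along an arc on which
`u₂ - u₁ ≥ M`. -/
def arcSet (o : Plane) (d r M k θ₀ : ℝ) (Ω : Set Plane) (u₁ u₂ : Plane → ℝ) : Set (Plane × ℝ) :=
  {x | (r ≤ ‖x.1 - o‖ ∧ θ₀ ≤ x.2 ∧ x.2 ≤ Real.pi / 2 ∧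
    ∀ t ∈ Set.Icc (0 : ℝ) 1, rotation o (t * x.2) x.1 ∈ {q ∈ closure Ω | M ≤ u₂ q - u₁ q}) ∧
    d + k * x.2 ≤ u₂ (rotation o x.2 x.1) - u₁ x.1}

namespace AngularPair

variable {a b c d r M k θ₀ : ℝ} {Ω : Set Plane} {u₁ u₂ : Plane → ℝ}

theorem isClosed_superlevel (h : AngularPair a b c d r Ω u₁ u₂) (M : ℝ) :
    IsClosed {q ∈ closure Ω | M ≤ u₂ q - u₁ q} :=
  isClosed_closure.isClosed_le continuousOn_const (h.continuousOn₂.sub h.continuousOn₁)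

theorem mem_of_superlevel (h : AngularPair a b c d r Ω u₁ u₂) (hM : d < M) {q : Plane}
    (hq : q ∈ {q ∈ closure Ω | M ≤ u₂ q - u₁ q}) : q ∈ Ω := by
  by_contra hn
  have hf : q ∈ frontier Ω := by rw [h.isOpen.frontier_eq]; exact ⟨hq.1, hn⟩
  have := h.boundary q hf
  linarith [hq.2]

theorem norm_sub_le (h : AngularPair a b c d r Ω u₁ u₂) {q : Plane} (hq : q ∈ closure Ω) :
    ‖q - !₂[a, b]‖ ≤ (q 0 - a) + (c - b) := by
  obtain ⟨h0, h1, h2⟩ := h.strip q hq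
  refine (le_abs_self _).trans (abs_le_of_sq_le_sq ?_ (by linarith))
  rw [norm_sq_eq]
  simp
  nlinarith

theorem mem_closure_of_arcSet {o : Plane} {x : Plane × ℝ}
    (hx : x ∈ arcSet o d r M k θ₀ Ω u₁ u₂) : x.1 ∈ closure Ω := by
  have := hx.1.2.2.2 0 (by simp)
  simp only [zero_mul, rotation_zero] at this
  exact this.1

theorem mem_closure_rotation_of_arcSet {o : Plane} {x : Plane × ℝ}
    (hx : x ∈ arcSet o d r M k θ₀ Ω u₁ u₂) : rotation o x.2 x.1 ∈ closure Ω := by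
  have := hx.1.2.2.2 1 (by simp)
  rw [one_mul] at this
  exact this.1

theorem isClosed_arcSet (h : AngularPair a b c d r Ω u₁ u₂) (o : Plane) (M k θ₀ : ℝ) :
    IsClosed (arcSet o d r M k θ₀ Ω u₁ u₂) := by
  have hrot := continuous_rotation o
  have hrot_mul : ∀ t : ℝ, Continuous fun x : Plane × ℝ => rotation o (t * x.2) x.1 := fun t =>
    hrot.comp (f := fun x : Plane × ℝ => (x.1, t * x.2)) (by fun_prop)
  have h1 : IsClosed {x : Plane × ℝ | r ≤ ‖x.1 - o‖ ∧ θ₀ ≤ x.2 ∧ x.2 ≤ Real.pi / 2 ∧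
      ∀ t ∈ Set.Icc (0 : ℝ) 1,
        rotation o (t * x.2) x.1 ∈ {q ∈ closure Ω | M ≤ u₂ q - u₁ q}} := by
    refine (isClosed_le (by fun_prop) (by fun_prop)).and <|
      (isClosed_le (by fun_prop) (by fun_prop)).and <|
      (isClosed_le (by fun_prop) (by fun_prop)).and ?_
    simp only [Set.ofPred_forall]
    exact isClosed_biInter fun t _ => (h.isClosed_superlevel M).preimage (hrot_mul t)
  refine h1.isClosed_le (by fun_prop) ?_
  refine (h.continuousOn₂.comp (f := fun x : Plane × ℝ => rotation o x.2 x.1) hrot.continuousOn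
    fun x hx => ?_).sub
    (h.continuousOn₁.comp (f := fun x : Plane × ℝ => x.1) continuous_fst.continuousOn
    fun x hx => ?_)
  · have := hx.2.2.2 1 (by simp)
    rw [one_mul] at this
    exact this.1
  · have := hx.2.2.2 0 (by simp)
    simp only [zero_mul, rotation_zero] at this
    exact this.1

/-- The endpoint of the arc has height at most `c`, so `sin θ * (x - a) ≤ c - b`; as `θ ≥ θ₀ > 0`,
this bounds `x`. -/
theorem isCompact_arcSet (h : AngularPair a b c d r Ω u₁ u₂) (M k : ℝ) (hθ₀ : 0 < θ₀) :
    IsCompact (arcSet !₂[a, b] d r M k θ₀ Ω u₁ u₂) := by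
  refine ((isCompact_closedBall (!₂[a, b] : Plane) ((c - b) / Real.sin θ₀ + (c - b))).prod
    (isCompact_Icc (a := θ₀) (b := Real.pi / 2))).of_isClosed_subset (h.isClosed_arcSet _ M k θ₀) ?_
  intro x hx
  have hx1 := mem_closure_of_arcSet hx
  have hx2 := mem_closure_rotation_of_arcSet hx
  obtain ⟨⟨-, hlo, hhi, -⟩, -⟩ := hx
  refine ⟨?_, hlo, hhi⟩
  rw [Metric.mem_closedBall, dist_eq_norm]
  refine (h.norm_sub_le hx1).trans ?_
  have hy := (h.strip _ hx2).2.2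
  simp [rotation] at hy
  obtain ⟨hX, hY, -⟩ := h.strip _ hx1
  have hpi := Real.pi_pos
  have hs0 : 0 < Real.sin θ₀ := Real.sin_pos_of_pos_of_lt_pi hθ₀ (by linarith)
  have hs : Real.sin θ₀ ≤ Real.sin x.2 := Real.sin_le_sin_of_le_of_le_pi_div_two (by linarith) hhi hlo
  have hc : 0 ≤ Real.cos x.2 := Real.cos_nonneg_of_mem_Icc ⟨by linarith, hhi⟩
  have h1 := mul_nonneg hc (sub_nonneg.2 hY)
  have h2 := mul_le_mul_of_nonneg_right hs (sub_nonneg.2 hX)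
  have : x.1 0 - a ≤ (c - b) / Real.sin θ₀ := by
    rw [le_div_iff₀ hs0]
    linarith
  linarith

/-- A quarter turn turns `x - a` into height, so `x - a ≤ c - b` and the starting point lies within
`2 * (c - b) < r` of the corner. -/
theorem angle_lt_of_arcSet (h : AngularPair a b c d r Ω u₁ u₂) {x : Plane × ℝ}
    (hx : x ∈ arcSet !₂[a, b] d r M k θ₀ Ω u₁ u₂) : x.2 < Real.pi / 2 := by
  refine lt_of_le_of_ne hx.1.2.2.1 fun he => ?_
  have hy := (h.strip _ (mem_closure_rotation_of_arcSet hx)).2.2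
  rw [he] at hy
  simp [rotation] at hy
  have := h.norm_sub_le (mem_closure_of_arcSet hx)
  linarith [h.two_mul_width_lt, hx.1.1]

/-- Along the arc `u₂` is at least its final value and `u₁` at most its initial value, so the bound
relating the two ends holds for `u₂ - u₁` at every point between. -/
theorem arc_bounds (h : AngularPair a b c d r Ω u₁ u₂) (hM : d < M) (hθ₀ : 0 < θ₀) {x : Plane × ℝ}
    (hx : x ∈ arcSet !₂[a, b] d r M k θ₀ Ω u₁ u₂) :
    ∀ t ∈ Set.Icc (0 : ℝ) 1, rotation !₂[a, b] (t * x.2) x.1 ∈ Ω ∧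
      d + k * x.2 ≤ u₂ (rotation !₂[a, b] (t * x.2) x.1) - u₁ (rotation !₂[a, b] (t * x.2) x.1) := by
  have hpos : 0 < x.2 := hθ₀.trans_le hx.1.2.1
  have hmem : ∀ t ∈ Set.Icc 0 x.2, rotation !₂[a, b] t x.1 ∈ Ω := fun t ht => by
    have := hx.1.2.2.2 (t / x.2) ⟨div_nonneg ht.1 hpos.le, (div_le_one hpos).2 ht.2⟩
    rw [div_mul_cancel₀ _ hpos.ne'] at this
    exact h.mem_of_superlevel hM this
  have hA1 := antitoneOn_rotation
    (fun q hq => (h.solvesAt₁ q hq).contDiffAt.differentiableAt two_ne_zero) h.antitone₁ hx.1.1 hmem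
  have hA2 := antitoneOn_rotation
    (fun q hq => (h.solvesAt₂ q hq).contDiffAt.differentiableAt two_ne_zero) h.antitone₂ hx.1.1 hmem
  intro t ht
  have ht' : t * x.2 ∈ Set.Icc 0 x.2 :=
    ⟨mul_nonneg ht.1 hpos.le, mul_le_of_le_one_left hpos.le ht.2⟩
  refine ⟨hmem _ ht', ?_⟩
  have e1 := hA1 (Set.left_mem_Icc.2 hpos.le) ht' ht'.1
  have e2 := hA2 ht' (Set.right_mem_Icc.2 hpos.le) ht'.2
  simp only [rotation_zero] at e1 e2
  linarith [hx.2]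

end AngularPair
-- Extremal angle and interior maxima
namespace AngularPair

variable {a b c d r M k θ₀ : ℝ} {Ω : Set Plane} {u₁ u₂ : Plane → ℝ}

theorem isOpen_strict_superlevel (h : AngularPair a b c d r Ω u₁ u₂) (M : ℝ) :
    IsOpen {q ∈ Ω | M < u₂ q - u₁ q} :=
  ((h.continuousOn₂.sub h.continuousOn₁).mono subset_closure).isOpen_inter_preimage h.isOpen
    isOpen_Ioi

/-- A tube-lemma argument; parametrising every arc by `[0, 1]` keeps the compact interval
independent of the angle. -/
theorem eventually_arc_mem {o : Plane} {O : Set Plane} (hO : IsOpen O) {x : Plane × ℝ}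
    (hx : ∀ t ∈ Set.Icc (0 : ℝ) 1, rotation o (t * x.2) x.1 ∈ O) :
    ∀ᶠ y in 𝓝 x, ∀ t ∈ Set.Icc (0 : ℝ) 1, rotation o (t * y.2) y.1 ∈ O := by
  refine isCompact_Icc.eventually_forall_of_forall_eventually fun t ht => ?_
  have hc : Continuous fun z : (Plane × ℝ) × ℝ => rotation o (z.2 * z.1.2) z.1.1 :=
    (continuous_rotation o).comp (f := fun z : (Plane × ℝ) × ℝ => (z.1.1, z.2 * z.1.2))
      (by fun_prop)
  exact hc.continuousAt.eventually (hO.mem_nhds (hx t ht))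

theorem arcSet_eq_empty (h : AngularPair a b c d r Ω u₁ u₂) (hM : d < M)
    (hle : ∀ q ∈ closure Ω, ‖q - !₂[a, b]‖ ≤ r → u₂ q - u₁ q ≤ M)
    (hθ₀ : 0 < θ₀) (hk : 0 ≤ k) (hkM : M < d + k * θ₀) :
    arcSet !₂[a, b] d r M k θ₀ Ω u₁ u₂ = ∅ := by
  by_contra hne
  set o : Plane := !₂[a, b] with ho
  set E := arcSet o d r M k θ₀ Ω u₁ u₂ with hE
  have hcpt : IsCompact E := h.isCompact_arcSet M k hθ₀
  obtain ⟨x, hx, hxmax⟩ := hcpt.exists_isMaxOn (Set.nonempty_iff_ne_empty.2 hne)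
    continuous_snd.continuousOn
  set θ := x.2 with hθ
  have hKcpt : IsCompact (E ∩ {y | y.2 = θ}) :=
    hcpt.inter_right (isClosed_eq continuous_snd continuous_const)
  have hcoord : Continuous fun y : Plane × ℝ => y.1 0 := by fun_prop
  -- Among pairs with the largest angle, take a leftmost starting point, as the strong maximum
  -- principle requires.
  obtain ⟨y, ⟨hyE, hyθ⟩, hymin⟩ := hKcpt.exists_isMinOn ⟨x, hx, rfl⟩ hcoord.continuousOn
  obtain ⟨p, θ'⟩ := y
  obtain rfl : θ' = θ := hyθ
  have harc := h.arc_bounds hM hθ₀ hyE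
  have hlt := h.angle_lt_of_arcSet hyE
  have hθlo : θ₀ ≤ θ := hyE.1.2.1
  simp only at harc hlt
  have hMθ : M < d + k * θ := hkM.trans_le (by gcongr)
  have harcO : ∀ t ∈ Set.Icc (0 : ℝ) 1, rotation o (t * θ) p ∈ {q ∈ Ω | M < u₂ q - u₁ q} :=
    fun t ht => ⟨(harc t ht).1, hMθ.trans_le (harc t ht).2⟩
  have hp : p ∈ {q ∈ Ω | M < u₂ q - u₁ q} := by simpa using harcO 0 (by simp)
  have hpθ : rotation o θ p ∈ Ω := by simpa using (harcO 1 (by simp)).1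
  have hrp : r < ‖p - o‖ := by
    by_contra! hcon
    have := hle p (subset_closure hp.1) hcon
    linarith [hp.2]
  -- The remaining constraints on distance, maximal angle and arc are strict at `(p, θ)`, so they
  -- persist nearby.
  have hev : ∀ᶠ z in 𝓝 (p, θ), θ ≤ z.2 →
      d + k * z.2 ≤ u₂ (rotation o z.2 z.1) - u₁ z.1 → z ∈ E := by
    have hcn : ContinuousAt (fun z : Plane × ℝ => ‖z.1 - o‖) (p, θ) := by fun_prop
    have hr' : ∀ᶠ z in 𝓝 (p, θ), r < ‖z.1 - o‖ := hcn.eventually_const_lt hrp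
    have hθ' : ∀ᶠ z in 𝓝 (p, θ), z.2 < Real.pi / 2 :=
      continuousAt_snd.eventually_lt_const hlt
    filter_upwards [hr', hθ',
      eventually_arc_mem (x := (p, θ)) (h.isOpen_strict_superlevel M) harcO] with z h1 h2 h3 h4 h5
    exact ⟨⟨h1.le, hθlo.trans h4, h2.le,
      fun t ht => ⟨subset_closure (h3 t ht).1, (h3 t ht).2.le⟩⟩, h5⟩
  have hrotΩ : ∀ᶠ q in 𝓝 p, rotation o θ q ∈ Ω :=
    (hasFDerivAt_rotation o θ p).continuousAt.eventually (h.isOpen.mem_nhds hpθ)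
  have hle' : ∀ᶠ q in 𝓝 p, u₂ (rotation o θ q) - u₁ q ≤ d + k * θ := by
    rw [nhds_prod_eq] at hev
    filter_upwards [hev.curry, hrotΩ] with q hq hqΩ
    -- A strict inequality at angle `θ` would survive at a slightly larger angle, against the
    -- maximality of `θ`.
    by_contra! hcon
    have hc : ContinuousAt (fun t => u₂ (rotation o t q) - u₁ q - (d + k * t)) θ := by
      have hu : ContinuousAt u₂ (rotation o θ q) :=
        (h.solvesAt₂ _ hqΩ).contDiffAt.continuousAt
      have hr : ContinuousAt (fun t => rotation o t q) θ := (hasDerivAt_rotation o θ q).continuousAt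
      have := ContinuousAt.comp (f := fun t => rotation o t q) hu hr
      exact (this.sub continuousAt_const).sub (by fun_prop)
    have hpos : ∀ᶠ t in 𝓝 θ, 0 < u₂ (rotation o t q) - u₁ q - (d + k * t) :=
      hc.eventually_const_lt (by linarith)
    obtain ⟨t, ⟨ht1, ht2⟩, ht3⟩ :=
      (((hq.and hpos).filter_mono nhdsWithin_le_nhds).and
        (self_mem_nhdsWithin (s := Set.Ioi θ))).exists
    have ht3' : θ < t := ht3
    have hmem := ht1 ht3'.le (by linarith)
    have : t ≤ θ := hxmax hmem
    linarith
  have hpeq : u₂ (rotation o θ p) - u₁ p = d + k * θ := le_antisymm hle'.self_of_nhds hyE.2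
  refine not_isLocalMax_sub_of_leftmost (u := u₁) (v := fun q => u₂ (rotation o θ q)) (p := p)
    ?_ ?_ ?_
  · filter_upwards [h.isOpen.mem_nhds hp.1, hrotΩ] with q hq hq'
    exact ⟨h.solvesAt₁ q hq, (h.solvesAt₂ _ hq').comp_rotation⟩
  · filter_upwards [hle'] with q hq
    linarith
  · have hslice : Tendsto (fun q : Plane => (q, θ)) (𝓝 p) (𝓝 (p, θ)) :=
      (Continuous.prodMk continuous_id continuous_const).tendsto p
    filter_upwards [hslice.eventually hev] with q hq heq
    exact hymin ⟨hq le_rfl (heq.trans hpeq).ge, rfl⟩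

/-- A point exceeding `M` would, by continuity, start an admissible arc of some small angle `θ₀`,
contradicting `arcSet_eq_empty`. -/
theorem sub_le_of_sub_le_near (h : AngularPair a b c d r Ω u₁ u₂) (hM : d < M)
    (hle : ∀ q ∈ closure Ω, ‖q - !₂[a, b]‖ ≤ r → u₂ q - u₁ q ≤ M) {p : Plane} (hp : p ∈ Ω) :
    u₂ p - u₁ p ≤ M := by
  by_contra! hcon
  set o : Plane := !₂[a, b] with ho
  obtain ⟨m, hm1, hm2⟩ := exists_between hcon
  have hr : Tendsto (fun t => rotation o t p) (𝓝 0) (𝓝 p) := by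
    simpa using (hasDerivAt_rotation o 0 p).continuousAt.tendsto
  have h1 : ∀ᶠ t in 𝓝 (0 : ℝ), rotation o t p ∈ {q ∈ Ω | M < u₂ q - u₁ q} :=
    hr.eventually ((h.isOpen_strict_superlevel M).mem_nhds ⟨hp, hcon⟩)
  have h2 : ∀ᶠ t in 𝓝 (0 : ℝ), m < u₂ (rotation o t p) - u₁ p :=
    ((((h.solvesAt₂ p hp).contDiffAt.continuousAt.tendsto.comp hr).sub_const _).eventually_const_lt
      hm2)
  obtain ⟨δ, hδ, hball⟩ := Metric.nhds_basis_closedBall.eventually_iff.1 (h1.and h2)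
  set θ₀ := min δ (Real.pi / 2) with hθ₀
  have hpos : 0 < θ₀ := lt_min hδ (by positivity)
  have hsmall : ∀ t, 0 ≤ t → t ≤ θ₀ → t ∈ Metric.closedBall (0 : ℝ) δ := fun t h0 ht => by
    rw [Metric.mem_closedBall, Real.dist_eq, sub_zero, abs_of_nonneg h0]
    exact ht.trans (min_le_left _ _)
  -- This slope makes the raise at angle `θ₀` exactly `m`, strictly between `M` and `u₂ p - u₁ p`.
  have hk : (m - d) / θ₀ * θ₀ = m - d := div_mul_cancel₀ _ hpos.ne'
  have hempty := h.arcSet_eq_empty (k := (m - d) / θ₀) hM hle hpos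
    (div_nonneg (by linarith) hpos.le) (by rw [hk]; linarith)
  have hmem : (p, θ₀) ∈ arcSet o d r M ((m - d) / θ₀) θ₀ Ω u₁ u₂ := by
    refine ⟨⟨?_, le_rfl, min_le_right _ _, fun t ht => ?_⟩, ?_⟩
    · by_contra! hcr
      have := hle p (subset_closure hp) hcr.le
      linarith
    · have := (hball (hsmall (t * θ₀) (mul_nonneg ht.1 hpos.le)
        (mul_le_of_le_one_left hpos.le ht.2))).1
      exact ⟨subset_closure this.1, this.2.le⟩
    · have := (hball (hsmall θ₀ hpos.le le_rfl)).2
      simp only [hk]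
      linarith
  rw [hempty] at hmem
  exact hmem

/-- A maximum above `d` is attained only off the boundary. The half-strip is bounded on the left, so
the maximum set has a leftmost point, which the strong maximum principle rules out. -/
theorem sub_le_of_exists_max (h : AngularPair a b c d r Ω u₁ u₂) {q : Plane} (hq : q ∈ Ω)
    (hmax : ∀ p ∈ Ω, u₂ p - u₁ p ≤ u₂ q - u₁ q) : u₂ q - u₁ q ≤ d := by
  by_contra! hcon
  set S := {p ∈ closure Ω | u₂ q - u₁ q ≤ u₂ p - u₁ p} with hS
  have hcpt : IsCompact (S ∩ {p | p 0 ≤ q 0}) := by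
    refine (isCompact_closedBall (!₂[a, b] : Plane) ((q 0 - a) + (c - b))).of_isClosed_subset
      ((h.isClosed_superlevel _).inter (isClosed_le (by fun_prop) continuous_const)) ?_
    rintro p ⟨hp, hpq⟩
    rw [Metric.mem_closedBall, dist_eq_norm]
    have hpq' : p 0 ≤ q 0 := hpq
    linarith [h.norm_sub_le hp.1]
  have hcoord : Continuous fun p : Plane => p 0 := by fun_prop
  obtain ⟨p, ⟨hpS, hpq⟩, hpmin⟩ := hcpt.exists_isMinOn
    ⟨q, ⟨subset_closure hq, le_rfl⟩, le_refl (q 0)⟩ hcoord.continuousOn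
  have hpΩ : p ∈ Ω := h.mem_of_superlevel hcon hpS
  have hnear : ∀ᶠ x in 𝓝 p, x ∈ Ω := h.isOpen.mem_nhds hpΩ
  refine not_isLocalMax_sub_of_leftmost (u := u₁) (v := u₂) (p := p)
    (hnear.mono fun x hx => ⟨h.solvesAt₁ x hx, h.solvesAt₂ x hx⟩)
    (hnear.mono fun x hx => (hmax x hx).trans hpS.2) (hnear.mono fun x hx heq => ?_)
  by_contra! hlt
  have hpq' : p 0 ≤ q 0 := hpq
  have : p 0 ≤ x 0 :=
    isMinOn_iff.1 hpmin x ⟨⟨subset_closure hx, hpS.2.trans heq.ge⟩, (hlt.le.trans hpq' : x 0 ≤ q 0)⟩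
  linarith

end AngularPair

/-! ### Choice of the radius and conclusion -/

theorem closure_halfStrip_subset {a b c : ℝ} {Ω : Set Plane} (hΩ : Ω ⊆ halfStrip a b c) :
    ∀ q ∈ closure Ω, a ≤ q 0 ∧ b ≤ q 1 ∧ q 1 ≤ c := by
  have hc : IsClosed {q : Plane | a ≤ q 0 ∧ b ≤ q 1 ∧ q 1 ≤ c} :=
    (isClosed_le (by fun_prop) (by fun_prop)).and <|
      (isClosed_le (by fun_prop) (by fun_prop)).and (isClosed_le (by fun_prop) (by fun_prop))
  have hsub : Ω ⊆ {q : Plane | a ≤ q 0 ∧ b ≤ q 1 ∧ q 1 ≤ c} := fun p hp =>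
    ⟨(hΩ hp).1, (hΩ hp).2.1.le, (hΩ hp).2.2.le⟩
  exact fun q hq => closure_minimal hsub hc hq

/-- The distance to the corner exceeds `q 0 - a` by at most `c - b`. The term `|x₀ - a|` then forces
`x₀ ≤ q 0`, and `(c - b) / ε` makes the height above `b` at most `ε * (q 0 - a)`. -/
theorem fderiv_quarterTurn_nonpos_of_far {a b c x₀ ε : ℝ} {Ω : Set Plane}
    (hΩ : Ω ⊆ halfStrip a b c) {u : Plane → ℝ} (hε : 0 < ε)
    (hν : ∀ p ∈ Ω, x₀ ≤ p 0 → ε < inner ℝ (upwardNormal u p) e₂)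
    {q : Plane} (hq : q ∈ Ω) (hfar : (c - b) + (c - b) / ε + |x₀ - a| ≤ ‖q - !₂[a, b]‖) :
    fderiv ℝ u q (quarterTurn (q - !₂[a, b])) ≤ 0 := by
  obtain ⟨h0, h1, h2⟩ := hΩ hq
  have hn : ‖q - !₂[a, b]‖ ≤ (q 0 - a) + (c - b) := by
    refine (le_abs_self _).trans (abs_le_of_sq_le_sq ?_ (by linarith))
    rw [norm_sq_eq]
    simp
    nlinarith
  have hd : 0 < (c - b) / ε := div_pos (by linarith) hε
  have habs := le_abs_self (x₀ - a)
  refine fderiv_quarterTurn_nonpos (hν q hq (by linarith)) (by simpa using h0)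
    (by simpa using h1.le) ?_
  have h3 : (c - b) / ε ≤ q 0 - a := by linarith [abs_nonneg (x₀ - a)]
  rw [div_le_iff₀' hε] at h3
  simp
  linarith

/-- One-sided form of the angular maximum principle. -/
theorem sub_le_of_boundary {a b c : ℝ} {Ω : Set Plane} (hΩ_open : IsOpen Ω)
    (hΩ_strip : Ω ⊆ halfStrip a b c) {u₁ u₂ : Plane → ℝ}
    (hu₁ : IsSolution Ω u₁) (hu₂ : IsSolution Ω u₂)
    (hu₁_cont : ContinuousOn u₁ (closure Ω)) (hu₂_cont : ContinuousOn u₂ (closure Ω))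
    {d : ℝ} (h_boundary : ∀ p ∈ frontier Ω, u₂ p - u₁ p = d) {x₀ ε : ℝ} (hε : 0 < ε)
    (hν₁ : ∀ p ∈ Ω, x₀ ≤ p 0 → ε < inner ℝ (upwardNormal u₁ p) e₂)
    (hν₂ : ∀ p ∈ Ω, x₀ ≤ p 0 → ε < inner ℝ (upwardNormal u₂ p) e₂)
    {p : Plane} (hp : p ∈ Ω) : u₂ p - u₁ p ≤ d := by
  by_contra! hcon
  -- Including `p` in the ball ensures that the maximum over it exceeds `d`.
  obtain ⟨r, hr1, hr2, hr3⟩ : ∃ r, 2 * (c - b) < r ∧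
      (c - b) + (c - b) / ε + |x₀ - a| ≤ r ∧ ‖p - !₂[a, b]‖ ≤ r :=
    ⟨max (2 * (c - b) + 1) (max ((c - b) + (c - b) / ε + |x₀ - a|) ‖p - !₂[a, b]‖),
      lt_max_of_lt_left (by linarith), le_max_of_le_right (le_max_left _ _),
      le_max_of_le_right (le_max_right _ _)⟩
  have h : AngularPair a b c d r Ω u₁ u₂ :=
    { isOpen := hΩ_open
      strip := closure_halfStrip_subset hΩ_strip
      solvesAt₁ := fun q hq => hu₁.solvesAt hΩ_open hq
      solvesAt₂ := fun q hq => hu₂.solvesAt hΩ_open hq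
      continuousOn₁ := hu₁_cont
      continuousOn₂ := hu₂_cont
      boundary := h_boundary
      antitone₁ := fun q hq hqr =>
        fderiv_quarterTurn_nonpos_of_far hΩ_strip hε hν₁ hq (hr2.trans hqr)
      antitone₂ := fun q hq hqr =>
        fderiv_quarterTurn_nonpos_of_far hΩ_strip hε hν₂ hq (hr2.trans hqr)
      two_mul_width_lt := hr1 }
  have hcpt : IsCompact (closure Ω ∩ Metric.closedBall !₂[a, b] r) :=
    (isCompact_closedBall _ _).inter_left isClosed_closure
  obtain ⟨q, hq, hqmax⟩ := hcpt.exists_isMaxOn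
    ⟨p, subset_closure hp, by rwa [Metric.mem_closedBall, dist_eq_norm]⟩
    ((hu₂_cont.sub hu₁_cont).mono Set.inter_subset_left)
  have hnear : ∀ x ∈ closure Ω, ‖x - !₂[a, b]‖ ≤ r → u₂ x - u₁ x ≤ u₂ q - u₁ q := fun x hx hxr =>
    hqmax ⟨hx, by rwa [Metric.mem_closedBall, dist_eq_norm]⟩
  have hd : d < u₂ q - u₁ q := hcon.trans_le (hnear p (subset_closure hp) hr3)
  have hqΩ : q ∈ Ω := h.mem_of_superlevel hd ⟨hq.1, le_rfl⟩
  exact hd.not_ge (h.sub_le_of_exists_max hqΩ fun x hx => h.sub_le_of_sub_le_near hd hnear hx)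

end Translator

/-- Angular maximum principle. The functions `u₁`, `u₂` stand for the continuous extensions to
the closure of `Ω` of the two solutions on `Ω`. -/
theorem theorem2 (a b c : ℝ) (Ω : Set Translator.Plane)
    (hΩ_open : IsOpen Ω) (hΩ_conn : IsConnected Ω)
    (hΩ_strip : Ω ⊆ Translator.halfStrip a b c)
    (u₁ u₂ : Translator.Plane → ℝ)
    (hu₁ : Translator.IsSolution Ω u₁) (hu₂ : Translator.IsSolution Ω u₂)
    (hu₁_cont : ContinuousOn u₁ (closure Ω)) (hu₂_cont : ContinuousOn u₂ (closure Ω))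
    (d : ℝ) (h_boundary : ∀ p ∈ frontier Ω, u₂ p - u₁ p = d)
    (x₀ ε : ℝ) (hε : 0 < ε)
    (hν₁ : ∀ p ∈ Ω, x₀ ≤ p 0 → ε < inner ℝ (Translator.upwardNormal u₁ p) Translator.e₂)
    (hν₂ : ∀ p ∈ Ω, x₀ ≤ p 0 → ε < inner ℝ (Translator.upwardNormal u₂ p) Translator.e₂) :
    ∀ p ∈ Ω, u₂ p - u₁ p = d := by
  intro p hp
  have hle := Translator.sub_le_of_boundary hΩ_open hΩ_strip hu₁ hu₂ hu₁_cont hu₂_cont h_boundary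
    hε hν₁ hν₂ hp
  have hge := Translator.sub_le_of_boundary (d := -d) hΩ_open hΩ_strip hu₂ hu₁ hu₂_cont hu₁_cont
    (fun q hq => by linarith [h_boundary q hq]) hε hν₂ hν₁ hp
  linarith
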